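/- Let $n\ge 1$, let $\mathcal F\subset\mathbb R^n$ be convex and compact, and let $\mathcal R$ be a self-concordant barrier for $\mathcal F$ with some parameter $\vartheta$: $\mathcal R$ is convex and $C^3$ on $\mathrm{int}(\mathcal F)$, for all $x\in\mathrm{int}(\mathcal F)$ and $u\in\mathbb R^n$ it satisfies $|D^3\mathcal R(x)[u,u,u]|\le 2\,(D^2\mathcal R(x)[u,u])^{3/2}$ and $(D\mathcal R(x)[u])^2\le\vartheta\, D^2\mathcal R(x)[u,u]$, and $\mathcal R(x)\to\infty$ as $x\in \mathrm{int}(\mathcal F)$ approaches the boundary; put $\mathcal R=+\infty$ outside $\mathrm{int}(\mathcal F)$. Assume $\min_{f\in\mathcal F}\mathcal R(f)=0$. Let $\mathcal X\subset\mathbb R^n$ and $s\in\mathbb R$ be such that $\langle f,x\rangle\in[0,s]$ for all $f\in\mathcal F$, $x\in\mathcal X$. The SCRiBLe algorithm with step size $\eta>0$ runs for $T$ rounds. At round $t=1,\dots,T$: - it computes $h_t\in\arg\min_{h\in\mathcal F}\big[\eta\langle h,\sum_{r<t}\tilde x_r\rangle+\mathcal R(h)\big]$ (so $h_1$ minimizes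 $\mathcal R$) and an orthonormal basis $v_1,\dots,v_n$ of eigenvectors of $\nabla^2\mathcal R(h_t)$ with eigenvalues $\lambda_1,\dots,\lambda_n$ (chosen in any way that depends only on the past); - it draws $i_t$ uniformly from $\{1,\dots,n\}$ and $\varepsilon_t$ uniformly from $\{1,-1\}$, independently of each other and of the earlier draws; - it predicts $f_t=h_t+\varepsilon_t\lambda_{i_t}^{-1/2}v_{i_t}$, observes the loss $\langle f_t,x_t\rangle$ of Nature's move $x_t\in\mathcal X$, and sets $\tilde x_t=n\langle f_t,x_t\rangle\,\varepsilon_t\lambda_{i_t}^{1/2}v_{i_t}$. Nature may be adaptive: $x_t$ may be any function of the learner's draws in rounds $1,\dots,t-1$. Suppose $\eta<1/(2sn^2)$, that is, $2sn^2\eta<1$ (no upper restriction on $\eta$ if $s=0$). Then for every $f^*\in\mathcal F$, $$\mathbb E\Big[\sum_{t=1}^T\langle f_t,x_t\rangle\Big]\le\frac{1}{1-2sn^2\eta}\left(\mathbb E\Big[\sum_{t=1}^T\langle f^*,x_t\rangle\Big]+\eta^{-1}\mathcal R(f^*)\right).$$ In particular, when the sequence $x_1,\dots,x_T$ is fixed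 in advance, the expectation on the right-hand side can be dropped. -/

import Mathlib

open scoped BigOperators RealInnerProductSpace Topology

/-- The second derivative `D²R(x)[u, w] = ⟨∇²R(x) u, w⟩`. -/
noncomputable def hessianForm {n : ℕ} (R : EuclideanSpace ℝ (Fin n) → ℝ)
    (x u w : EuclideanSpace ℝ (Fin n)) : ℝ :=
  iteratedFDeriv ℝ 2 R x ![u, w]

/-- `R` is a self-concordant barrier for `F` with parameter `ϑ`. Only the values of `R` on the
interior of `F` matter. -/
structure IsSelfConcordantBarrier {n : ℕ} (F : Set (EuclideanSpace ℝ (Fin n)))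
    (R : EuclideanSpace ℝ (Fin n) → ℝ) (ϑ : ℝ) : Prop where
  contDiffOn : ContDiffOn ℝ 3 R (interior F)
  convexOn : ConvexOn ℝ (interior F) R
  /-- Self-concordance: `|D³R(x)[u, u, u]| ≤ 2 (D²R(x)[u, u])^{3/2}`. -/
  abs_third_le : ∀ x ∈ interior F, ∀ u : EuclideanSpace ℝ (Fin n),
    |iteratedFDeriv ℝ 3 R x (fun _ => u)| ≤ 2 * (hessianForm R x u u) ^ (3 / 2 : ℝ)
  /-- `R` blows up at the boundary. -/
  tendsto_atTop : ∀ x ∈ frontier F, Filter.Tendsto R (𝓝[interior F] x) Filter.atTop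
  /-- The barrier parameter: `|DR(x)[u]| ≤ ϑ^{1/2} (D²R(x)[u, u])^{1/2}`. -/
  sq_fderiv_le : ∀ x ∈ interior F, ∀ u : EuclideanSpace ℝ (Fin n),
    (fderiv ℝ R x u) ^ 2 ≤ ϑ * hessianForm R x u u

open Classical in
/-- The barrier as an extended-valued function: `R` on the interior of `F`, and `+∞` elsewhere
(in particular on the boundary of `F`). -/
noncomputable def extBarrier {n : ℕ} (F : Set (EuclideanSpace ℝ (Fin n)))
    (R : EuclideanSpace ℝ (Fin n) → ℝ) (f : EuclideanSpace ℝ (Fin n)) : EReal :=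
  if f ∈ interior F then ((R f : ℝ) : EReal) else ⊤

/-- The learner's coins in `T` rounds: an index `i_t ∈ {1, …, n}` and a sign `ε_t ∈ {1, -1}` in each
round. The uniform distribution on this finite set makes all of them independent and uniform. -/
abbrev Coins (n T : ℕ) : Type := Fin T → Fin n × ℤˣ

/-- A quantity for round `t` is decided before the coins of round `t` are tossed: it depends only on
the coins of the earlier rounds. -/
def DecidedBefore {n T : ℕ} {α : Type*} (g : Fin T → Coins n T → α) : Prop :=
  ∀ (t : Fin T) (ω ω' : Coins n T), (∀ r : Fin T, r < t → ω r = ω' r) → g t ω = g t ω'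

/-- A run of SCRiBLe over `T` rounds against Nature's moves `x`. The fields are the
quantities that the algorithm computes and the rules that it follows; ties in the choice of the
eigenbasis may be broken in any way that does not look at present or future coins. -/
structure ScribleRun {n : ℕ} (F : Set (EuclideanSpace ℝ (Fin n)))
    (R : EuclideanSpace ℝ (Fin n) → ℝ) (η : ℝ) (T : ℕ)
    (x : Fin T → Coins n T → EuclideanSpace ℝ (Fin n)) where
  /-- The centre `h_t`. -/
  h : Fin T → Coins n T → EuclideanSpace ℝ (Fin n)
  /-- The orthonormal eigenvectors of `∇²R(h_t)`. -/
  v : Fin T → Coins n T → OrthonormalBasis (Fin n) ℝ (EuclideanSpace ℝ (Fin n))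
  /-- The eigenvalues of `∇²R(h_t)`. -/
  eigval : Fin T → Coins n T → Fin n → ℝ
  /-- The prediction `f_t`. -/
  f : Fin T → Coins n T → EuclideanSpace ℝ (Fin n)
  /-- The estimated move. -/
  xEst : Fin T → Coins n T → EuclideanSpace ℝ (Fin n)
  h_decidedBefore : DecidedBefore h
  v_decidedBefore : DecidedBefore v
  /-- `h_t` minimizes `η ⟨g, ∑_{r < t} xEst_r⟩ + R(g)` over `g ∈ F`; in the first round the sum is
  empty and `h_1` minimizes `R`. -/
  h_mem : ∀ t ω, h t ω ∈ F
  h_isMinOn : ∀ t ω, IsMinOn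
    (fun g => ((η * ⟪g, ∑ r ∈ Finset.Iio t, xEst r ω⟫ : ℝ) : EReal) + extBarrier F R g) F (h t ω)
  v_eigen : ∀ t ω i w, hessianForm R (h t ω) (v t ω i) w = eigval t ω i * ⟪v t ω i, w⟫
  f_eq : ∀ t ω, f t ω = h t ω +
    ((((ω t).2 : ℤ) : ℝ) * (√(eigval t ω (ω t).1))⁻¹) • v t ω (ω t).1
  xEst_eq : ∀ t ω, xEst t ω =
    ((n : ℝ) * ⟪f t ω, x t ω⟫ * (((ω t).2 : ℤ) : ℝ) * √(eigval t ω (ω t).1)) • v t ω (ω t).1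

/-! ### Derivatives along a line. -/

section LineCalculus

variable {E : Type*} [NormedAddCommGroup E] [NormedSpace ℝ E]

/-! Since `x̃_t` is an unbiased estimate of `x_t` and `f_t` is centred at `h_t`, the true and
estimated regret terms agree in expectation (`expect_inner_f_sub`). It remains to bound, path by
path, the regret of follow-the-regularized-leader on the estimates.

Let `r` be the local norm of `g - h` at `h`. Self-concordance gives `R(g) ≥ R(h) + DR(h)[g - h] + r
- log(1 + r)` (`add_sub_log_le`). At the minimizer `h_t` the first-order terms cancel, and pairing
`g - h_t` with `η x̃_t` costs at most `a r`, where `a = η n ⟨f_t, x_t⟩ ≤ 1/2`. So the updated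
objective is nowhere more than `2a²` below its value at `h_t` (`le_inner_add_of_isMinOn`). Induction
over rounds gives regret at most `∑ 2 η n² ⟨f_t, x_t⟩² + R(f*)/η` for an interior comparator.

Losses lie in `[0, s]`, so each square is at most `s` times the loss. The learner's own loss then
stands on both sides, and solving for it yields the factor `1/(1 - 2 s n² η)`. The loss range
applies to `f_t` because the closed Dikin ellipsoid lies in `F` (`add_mem`). -/

/-- The derivative along a line of an iterated derivative evaluated on the direction of the line. -/
theorem hasDerivAt_iteratedFDeriv_line {R : E → ℝ} {k : ℕ} {h u : E} {t : ℝ}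
    (hR : ContDiffAt ℝ (k + 1) R (h + t • u)) :
    HasDerivAt (fun t : ℝ => iteratedFDeriv ℝ k R (h + t • u) (fun _ => u))
      (iteratedFDeriv ℝ (k + 1) R (h + t • u) (fun _ => u)) t := by
  have hd : DifferentiableAt ℝ (iteratedFDeriv ℝ k R) (h + t • u) :=
    hR.differentiableAt_iteratedFDeriv (by exact_mod_cast Nat.lt_succ_self k)
  have hl : HasDerivAt (fun t : ℝ => h + t • u) u t := by
    simpa using ((hasDerivAt_id t).smul_const u).const_add h
  have hc := hd.hasFDerivAt.comp_hasDerivAt t hl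
  rw [iteratedFDeriv_succ_apply_left]
  have := ((ContinuousMultilinearMap.apply ℝ (fun _ : Fin k => E) ℝ
    (fun _ => u)).hasFDerivAt).comp_hasDerivAt t hc
  exact this

theorem hasDerivAt_line {R : E → ℝ} {h u : E} {t : ℝ} (hR : ContDiffAt ℝ 1 R (h + t • u)) :
    HasDerivAt (fun t : ℝ => R (h + t • u)) (fderiv ℝ R (h + t • u) u) t := by
  have := hasDerivAt_iteratedFDeriv_line (k := 0) (R := R) (h := h) (u := u) (t := t)
    (by simpa using hR)
  simpa [iteratedFDeriv_one_apply] using this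

theorem hasDerivAt_fderiv_line {R : E → ℝ} {h u : E} {t : ℝ}
    (hR : ContDiffAt ℝ 2 R (h + t • u)) :
    HasDerivAt (fun t : ℝ => fderiv ℝ R (h + t • u) u)
      (iteratedFDeriv ℝ 2 R (h + t • u) (fun _ => u)) t := by
  have := hasDerivAt_iteratedFDeriv_line (k := 1) (R := R) (h := h) (u := u) (t := t)
    (by norm_num; exact hR)
  simpa [iteratedFDeriv_one_apply] using this

/-- The second derivative of a convex function is nonnegative. -/
theorem iteratedFDeriv_two_nonneg_of_convexOn {R : E → ℝ} {U : Set E} (hU : IsOpen U)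
    (hc : ConvexOn ℝ U R) (hR : ContDiffOn ℝ 2 R U) {x : E} (hx : x ∈ U) (u : E) :
    0 ≤ iteratedFDeriv ℝ 2 R x (fun _ => u) := by
  let V : Set ℝ := (fun t : ℝ => x + t • u) ⁻¹' U
  have hV : IsOpen V := hU.preimage (by fun_prop)
  have h0 : (0 : ℝ) ∈ V := by simpa [V] using hx
  have hat : ∀ t ∈ V, ContDiffAt ℝ 2 R (x + t • u) := fun t ht =>
    hR.contDiffAt (hU.mem_nhds ht)
  have hline : (fun t : ℝ => x + t • u) = AffineMap.lineMap x (x + u) := by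
    ext t; simp [AffineMap.lineMap_apply, add_comm]
  have hφ : ConvexOn ℝ V (fun t : ℝ => R (x + t • u)) := by
    have := hc.comp_affineMap (AffineMap.lineMap x (x + u) : ℝ →ᵃ[ℝ] E)
    rw [← hline] at this
    exact this
  have hder : ∀ t ∈ V, HasDerivAt (fun t : ℝ => R (x + t • u)) (fderiv ℝ R (x + t • u) u) t :=
    fun t ht => hasDerivAt_line ((hat t ht).of_le (by norm_num))
  -- Convexity enters only here: the slope along the line is monotone, so its derivative at `0` is
  -- nonnegative.
  have hmono : MonotoneOn (fun t : ℝ => fderiv ℝ R (x + t • u) u) V := by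
    have := hφ.monotoneOn_deriv (fun t ht => (hder t ht).differentiableAt)
    exact this.congr (fun t ht => (hder t ht).deriv)
  have hd2 := hasDerivAt_fderiv_line (u := u) (hat 0 h0)
  rw [zero_smul, add_zero] at hd2
  have : 0 ≤ derivWithin (fun t : ℝ => fderiv ℝ R (x + t • u) u) V 0 := hmono.derivWithin_nonneg
  rwa [derivWithin_of_mem_nhds (hV.mem_nhds h0), hd2.deriv] at this

end LineCalculus

/-! ### One-variable inequalities behind self-concordance. -/

section ScalarComparison

/-- If `|q'| ≤ 2 q^{3/2}` then `1 / √(q + δ)` is `1`-Lipschitz. -/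
theorem abs_inv_sqrt_add_sub_le {q q' : ℝ → ℝ} {b : ℝ} {δ : ℝ} (hδ : 0 < δ)
    (hq : ∀ t ∈ Set.Icc 0 b, HasDerivAt q (q' t) t) (hq0 : ∀ t ∈ Set.Icc 0 b, 0 ≤ q t)
    (hq' : ∀ t ∈ Set.Icc 0 b, |q' t| ≤ 2 * q t ^ (3 / 2 : ℝ)) (hb : 0 ≤ b) :
    |(√(q b + δ))⁻¹ - (√(q 0 + δ))⁻¹| ≤ b := by
  -- The shift `δ` keeps the reciprocal root differentiable where `q` vanishes; the exponent `3/2`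
  -- is what bounds this derivative by `1`.
  have hder : ∀ t ∈ Set.Icc 0 b, HasDerivWithinAt (fun t => (√(q t + δ))⁻¹)
      (-(q' t / (2 * √(q t + δ))) / √(q t + δ) ^ 2) (Set.Icc 0 b) t := fun t ht => by
    have hp : 0 < q t + δ := add_pos_of_nonneg_of_pos (hq0 t ht) hδ
    exact ((((hq t ht).add_const δ).sqrt hp.ne').inv (Real.sqrt_pos.2 hp).ne').hasDerivWithinAt
  have hbound : ∀ t ∈ Set.Icc 0 b,
      ‖-(q' t / (2 * √(q t + δ))) / √(q t + δ) ^ 2‖ ≤ 1 := fun t ht => by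
    have hp : 0 < q t + δ := add_pos_of_nonneg_of_pos (hq0 t ht) hδ
    have hs : 0 < √(q t + δ) := Real.sqrt_pos.2 hp
    have hle : q t ^ (3 / 2 : ℝ) ≤ √(q t + δ) ^ 3 := by
      calc q t ^ (3 / 2 : ℝ) ≤ (q t + δ) ^ (3 / 2 : ℝ) :=
            Real.rpow_le_rpow (hq0 t ht) (by linarith) (by norm_num)
        _ = √(q t + δ) ^ 3 := by
            rw [Real.sqrt_eq_rpow, ← Real.rpow_natCast, ← Real.rpow_mul hp.le]; norm_num
    rw [norm_div, norm_neg, norm_div, Real.norm_eq_abs, Real.norm_of_nonneg (by positivity),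
      Real.norm_of_nonneg (by positivity), div_div, div_le_one (by positivity)]
    have := hq' t ht
    nlinarith
  have := (convex_Icc 0 b).norm_image_sub_le_of_norm_hasDerivWithin_le hder hbound
    (Set.left_mem_Icc.2 hb) (Set.right_mem_Icc.2 hb)
  simpa [abs_of_nonneg hb] using this

/-- Lower comparison: `q(t) ≥ r² / (1 + r t)²` with `r = √q(0)`. -/
theorem sq_div_le_of_abs_deriv_le {q q' : ℝ → ℝ} {b : ℝ}
    (hq : ∀ t ∈ Set.Icc 0 b, HasDerivAt q (q' t) t) (hq0 : ∀ t ∈ Set.Icc 0 b, 0 ≤ q t)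
    (hq' : ∀ t ∈ Set.Icc 0 b, |q' t| ≤ 2 * q t ^ (3 / 2 : ℝ)) (hb : 0 ≤ b) :
    √(q 0) ^ 2 / (1 + √(q 0) * b) ^ 2 ≤ q b := by
  have hq00 := hq0 0 (Set.left_mem_Icc.2 hb)
  have key : ∀ δ : ℝ, 0 < δ → √(q 0 + δ) ^ 2 / (1 + √(q 0 + δ) * b) ^ 2 ≤ q b + δ := by
    intro δ hδ
    have h1 := (abs_le.1 (abs_inv_sqrt_add_sub_le hδ hq hq0 hq' hb)).2
    have hqb : 0 < q b + δ := add_pos_of_nonneg_of_pos (hq0 b (Set.right_mem_Icc.2 hb)) hδ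
    have hp : 0 < √(q 0 + δ) := Real.sqrt_pos.2 (by linarith)
    have hpb : 0 < √(q b + δ) := Real.sqrt_pos.2 hqb
    have h2 : √(q 0 + δ) / (1 + √(q 0 + δ) * b) ≤ √(q b + δ) := by
      rw [div_le_iff₀ (by positivity)]
      have h3 : (√(q b + δ))⁻¹ ≤ (√(q 0 + δ))⁻¹ + b := by linarith
      have h4 := mul_le_mul_of_nonneg_left h3 (mul_pos hp hpb).le
      field_simp at h4
      nlinarith
    calc √(q 0 + δ) ^ 2 / (1 + √(q 0 + δ) * b) ^ 2
        = (√(q 0 + δ) / (1 + √(q 0 + δ) * b)) ^ 2 := by rw [div_pow]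
      _ ≤ √(q b + δ) ^ 2 := pow_le_pow_left₀ (by positivity) h2 2
      _ = q b + δ := Real.sq_sqrt hqb.le
  -- Remove the shift by letting `δ` tend to `0` from the right.
  have hne : (1 + √(q 0 + 0) * b) ^ 2 ≠ 0 := by positivity
  have hl : Filter.Tendsto (fun δ : ℝ => √(q 0 + δ) ^ 2 / (1 + √(q 0 + δ) * b) ^ 2) (𝓝[>] 0)
      (𝓝 (√(q 0 + 0) ^ 2 / (1 + √(q 0 + 0) * b) ^ 2)) := by
    refine (ContinuousAt.tendsto (f := fun δ : ℝ =>
      √(q 0 + δ) ^ 2 / (1 + √(q 0 + δ) * b) ^ 2) ?_).mono_left nhdsWithin_le_nhds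
    exact ContinuousAt.div (by fun_prop) (by fun_prop) hne
  have hr : Filter.Tendsto (fun δ : ℝ => q b + δ) (𝓝[>] 0) (𝓝 (q b + 0)) :=
    (ContinuousAt.tendsto (f := fun δ : ℝ => q b + δ) (by fun_prop)).mono_left
      nhdsWithin_le_nhds
  have := le_of_tendsto_of_tendsto hl hr
    (Filter.eventually_of_mem self_mem_nhdsWithin fun δ hδ => key δ hδ)
  simpa using this

/-- Upper comparison: if `q(0) < 1`, then `q` is bounded on `[0, 1]`, by a bound that depends only
on `q(0)`. -/
theorem exists_bound_of_abs_deriv_le {c : ℝ} (hc0 : 0 ≤ c) (hc : c < 1) :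
    ∃ M : ℝ, ∀ (q q' : ℝ → ℝ) (b : ℝ), q 0 = c → 0 ≤ b → b ≤ 1 →
      (∀ t ∈ Set.Icc 0 b, HasDerivAt q (q' t) t) → (∀ t ∈ Set.Icc 0 b, 0 ≤ q t) →
      (∀ t ∈ Set.Icc 0 b, |q' t| ≤ 2 * q t ^ (3 / 2 : ℝ)) → q b ≤ M := by
  -- With `c + δ < 1` the reciprocal root starts above `1`; it drops by at most `b ≤ 1`, so it stays
  -- bounded away from `0`.
  obtain ⟨δ, hδ, hcδ⟩ : ∃ δ : ℝ, 0 < δ ∧ c + δ < 1 := ⟨(1 - c) / 2, by linarith, by linarith⟩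
  have hp : 0 < √(c + δ) := Real.sqrt_pos.2 (by linarith)
  have hp1 : √(c + δ) < 1 := by
    rw [Real.sqrt_lt' one_pos]; simpa using hcδ
  have hd : 0 < (√(c + δ))⁻¹ - 1 := sub_pos.2 ((one_lt_inv₀ hp).2 hp1)
  refine ⟨(((√(c + δ))⁻¹ - 1)⁻¹) ^ 2, fun q q' b hqc hb hb1 hq hq0 hq' => ?_⟩
  have h1 := (abs_le.1 (abs_inv_sqrt_add_sub_le hδ hq hq0 hq' hb)).1
  rw [hqc] at h1
  have hqb : 0 < q b + δ := add_pos_of_nonneg_of_pos (hq0 b (Set.right_mem_Icc.2 hb)) hδ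
  have hpb : 0 < √(q b + δ) := Real.sqrt_pos.2 hqb
  have h2 : √(q b + δ) ≤ ((√(c + δ))⁻¹ - 1)⁻¹ :=
    (le_inv_comm₀ hpb hd).2 (by linarith)
  calc q b ≤ √(q b + δ) ^ 2 := by rw [Real.sq_sqrt hqb.le]; linarith
    _ ≤ _ := pow_le_pow_left₀ hpb.le h2 2

/-- Integrating `q ≥ r² / (1 + r t)²` twice. -/
theorem add_sub_log_le_of_sq_div_le {φ φ' q : ℝ → ℝ} {r : ℝ} (hr : 0 ≤ r)
    (hφ : ∀ t ∈ Set.Icc (0 : ℝ) 1, HasDerivAt φ (φ' t) t)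
    (hφ' : ∀ t ∈ Set.Icc (0 : ℝ) 1, HasDerivAt φ' (q t) t)
    (hq : ∀ t ∈ Set.Icc (0 : ℝ) 1, r ^ 2 / (1 + r * t) ^ 2 ≤ q t) :
    φ 0 + φ' 0 + (r - Real.log (1 + r)) ≤ φ 1 := by
  have hpos : ∀ t ∈ Set.Icc (0 : ℝ) 1, 0 < 1 + r * t := fun t ht => by
    have := mul_nonneg hr ht.1; linarith
  have hlin : ∀ t : ℝ, HasDerivAt (fun t : ℝ => 1 + r * t) r t := fun t => by
    simpa using ((hasDerivAt_id t).const_mul r).const_add 1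
  have mono : ∀ {ψ ψ' : ℝ → ℝ}, (∀ t ∈ Set.Icc (0 : ℝ) 1, HasDerivAt ψ (ψ' t) t) →
      (∀ t ∈ Set.Icc (0 : ℝ) 1, 0 ≤ ψ' t) → ∀ t ∈ Set.Icc (0 : ℝ) 1, ψ 0 ≤ ψ t := by
    intro ψ ψ' hd hn t ht
    refine monotoneOn_of_deriv_nonneg (convex_Icc 0 1)
      (fun t ht => (hd t ht).continuousAt.continuousWithinAt)
      (fun t ht => (hd t (interior_subset ht)).differentiableAt.differentiableWithinAt)
      (fun t ht => ?_) (Set.left_mem_Icc.2 zero_le_one) ht ht.1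
    rw [(hd t (interior_subset ht)).deriv]
    exact hn t (interior_subset ht)
  -- The lower bound on `q` is minus the derivative of `r / (1 + r t)`, whose antiderivative is `log
  -- (1 + r t)`.
  have h1 : ∀ t ∈ Set.Icc (0 : ℝ) 1, φ' 0 + r ≤ φ' t + r * (1 + r * t)⁻¹ := by
    intro t ht
    have := mono (ψ := fun t => φ' t + r * (1 + r * t)⁻¹)
      (fun t ht => (hφ' t ht).add (((hlin t).inv (hpos t ht).ne').const_mul r))
      (fun t ht => by
        have := hq t ht
        have e : r * (-r / (1 + r * t) ^ 2) = -(r ^ 2 / (1 + r * t) ^ 2) := by ring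
        rw [e]; linarith) t ht
    simpa using this
  have h2 := mono (ψ := fun t => φ t - (φ' 0 + r) * t + Real.log (1 + r * t))
      (fun t ht => ((hφ t ht).sub ((hasDerivAt_id t).const_mul (φ' 0 + r))).add
        ((hlin t).log (hpos t ht).ne'))
      (fun t ht => by
        have := h1 t ht
        rw [div_eq_mul_inv]; linarith) 1 (Set.right_mem_Icc.2 zero_le_one)
  simp at h2
  linarith

/-- Integrating `q ≤ M` twice. -/
theorem le_of_second_deriv_le {φ φ' q : ℝ → ℝ} {b M : ℝ} (hb : 0 ≤ b)
    (hφ : ∀ t ∈ Set.Icc (0 : ℝ) b, HasDerivAt φ (φ' t) t)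
    (hφ' : ∀ t ∈ Set.Icc (0 : ℝ) b, HasDerivAt φ' (q t) t)
    (hq : ∀ t ∈ Set.Icc (0 : ℝ) b, q t ≤ M) :
    φ b ≤ φ 0 + φ' 0 * b + M / 2 * b ^ 2 := by
  have anti : ∀ {ψ ψ' : ℝ → ℝ}, (∀ t ∈ Set.Icc (0 : ℝ) b, HasDerivAt ψ (ψ' t) t) →
      (∀ t ∈ Set.Icc (0 : ℝ) b, ψ' t ≤ 0) → ∀ t ∈ Set.Icc (0 : ℝ) b, ψ t ≤ ψ 0 := by
    intro ψ ψ' hd hn t ht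
    refine antitoneOn_of_deriv_nonpos (convex_Icc 0 b)
      (fun t ht => (hd t ht).continuousAt.continuousWithinAt)
      (fun t ht => (hd t (interior_subset ht)).differentiableAt.differentiableWithinAt)
      (fun t ht => ?_) (Set.left_mem_Icc.2 hb) ht ht.1
    rw [(hd t (interior_subset ht)).deriv]
    exact hn t (interior_subset ht)
  have h1 : ∀ t ∈ Set.Icc (0 : ℝ) b, φ' t - M * t ≤ φ' 0 := by
    intro t ht
    have := anti (ψ := fun t => φ' t - M * t)
      (fun t ht => (hφ' t ht).sub ((hasDerivAt_id t).const_mul M))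
      (fun t ht => by have := hq t ht; linarith) t ht
    simpa using this
  have h2 := anti (ψ := fun t => φ t - φ' 0 * t - M / 2 * t ^ 2)
      (fun t ht => ((hφ t ht).sub ((hasDerivAt_id t).const_mul (φ' 0))).sub
        ((hasDerivAt_pow 2 t).const_mul (M / 2)))
      (fun t ht => by
        have := h1 t ht
        norm_num; linarith) b (Set.right_mem_Icc.2 hb)
  simp at h2
  linarith

/-- The Legendre-type bound `r - log (1 + r) - a r ≥ -2 a²` for `a ≤ 1 / 2`. -/
theorem neg_two_mul_sq_le_sub_log {a r : ℝ} (ha2 : a ≤ 1 / 2) (hr : 0 ≤ r) :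
    -(2 * a ^ 2) ≤ r - Real.log (1 + r) - a * r := by
  have h1a : 0 < 1 - a := by linarith
  -- Eliminates `r`: the left side of the conjugate inequality is at least `a + log (1 - a)`, with
  -- equality when `(1 + r)(1 - a) = 1`.
  have h1 : Real.log (1 + r) + Real.log (1 - a) ≤ (1 + r) * (1 - a) - 1 := by
    rw [← Real.log_mul (by positivity) h1a.ne']
    exact Real.log_le_sub_one_of_pos (by positivity)
  have h2 := Real.one_sub_inv_le_log_of_pos h1a
  have h3 : (1 - a)⁻¹ ≤ 1 + a + 2 * a ^ 2 := by
    rw [inv_le_iff_one_le_mul₀ h1a]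
    nlinarith [mul_nonneg (sq_nonneg a) (sub_nonneg.2 ha2)]
  nlinarith

end ScalarComparison

/-! ### Self-concordant barriers: Dikin ellipsoids and stability of minimizers. -/

section Barrier

variable {n : ℕ} {F : Set (EuclideanSpace ℝ (Fin n))} {R : EuclideanSpace ℝ (Fin n) → ℝ} {ϑ : ℝ}

theorem hessianForm_self (R : EuclideanSpace ℝ (Fin n) → ℝ) (x u : EuclideanSpace ℝ (Fin n)) :
    hessianForm R x u u = iteratedFDeriv ℝ 2 R x (fun _ => u) := by
  unfold hessianForm
  congr 1
  ext i
  fin_cases i <;> rfl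

theorem hessianForm_eq_fderiv (R : EuclideanSpace ℝ (Fin n) → ℝ)
    (x u w : EuclideanSpace ℝ (Fin n)) :
    hessianForm R x u w = fderiv ℝ (fderiv ℝ R) x u w := by
  simp [hessianForm, iteratedFDeriv_two_apply]

theorem hessianForm_smul_self (R : EuclideanSpace ℝ (Fin n) → ℝ)
    (x u : EuclideanSpace ℝ (Fin n)) (c : ℝ) :
    hessianForm R x (c • u) (c • u) = c ^ 2 * hessianForm R x u u := by
  simp only [hessianForm_eq_fderiv, map_smul, smul_apply, smul_eq_mul]
  ring

/-- The Hessian form is diagonal in an eigenbasis. -/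
theorem hessianForm_eq_sum {x : EuclideanSpace ℝ (Fin n)}
    {v : OrthonormalBasis (Fin n) ℝ (EuclideanSpace ℝ (Fin n))} {μ : Fin n → ℝ}
    (hv : ∀ i w, hessianForm R x (v i) w = μ i * ⟪v i, w⟫) (u : EuclideanSpace ℝ (Fin n)) :
    hessianForm R x u u = ∑ i, μ i * ⟪v i, u⟫ ^ 2 := by
  have h : hessianForm R x (∑ i, ⟪v i, u⟫ • v i) u = ∑ i, μ i * ⟪v i, u⟫ ^ 2 := by
    simp only [hessianForm_eq_fderiv, map_sum, map_smul, sum_apply,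
      smul_apply, smul_eq_mul] at hv ⊢
    exact Finset.sum_congr rfl fun i _ => by rw [hv]; ring
  rwa [v.sum_repr'] at h

namespace IsSelfConcordantBarrier

theorem contDiffAt (hR : IsSelfConcordantBarrier F R ϑ) {x : EuclideanSpace ℝ (Fin n)}
    (hx : x ∈ interior F) : ContDiffAt ℝ 3 R x :=
  hR.contDiffOn.contDiffAt (isOpen_interior.mem_nhds hx)

theorem hessianForm_self_nonneg (hR : IsSelfConcordantBarrier F R ϑ)
    {x : EuclideanSpace ℝ (Fin n)} (hx : x ∈ interior F) (u : EuclideanSpace ℝ (Fin n)) :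
    0 ≤ hessianForm R x u u := by
  rw [hessianForm_self]
  exact iteratedFDeriv_two_nonneg_of_convexOn isOpen_interior hR.convexOn
    (hR.contDiffOn.of_le (by norm_num)) hx u

theorem hasDerivAt_line (hR : IsSelfConcordantBarrier F R ϑ) {h u : EuclideanSpace ℝ (Fin n)}
    {t : ℝ} (ht : h + t • u ∈ interior F) :
    HasDerivAt (fun t : ℝ => R (h + t • u)) (fderiv ℝ R (h + t • u) u) t :=
  _root_.hasDerivAt_line ((hR.contDiffAt ht).of_le (by norm_num))

theorem hasDerivAt_fderiv_line (hR : IsSelfConcordantBarrier F R ϑ)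
    {h u : EuclideanSpace ℝ (Fin n)} {t : ℝ} (ht : h + t • u ∈ interior F) :
    HasDerivAt (fun t : ℝ => fderiv ℝ R (h + t • u) u) (hessianForm R (h + t • u) u u) t := by
  rw [hessianForm_self]
  exact _root_.hasDerivAt_fderiv_line ((hR.contDiffAt ht).of_le (by norm_num))

theorem hasDerivAt_hessianForm_line (hR : IsSelfConcordantBarrier F R ϑ)
    {h u : EuclideanSpace ℝ (Fin n)} {t : ℝ} (ht : h + t • u ∈ interior F) :
    HasDerivAt (fun t : ℝ => hessianForm R (h + t • u) u u)
      (iteratedFDeriv ℝ 3 R (h + t • u) (fun _ => u)) t := by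
  simp only [hessianForm_self]
  exact hasDerivAt_iteratedFDeriv_line (k := 2) (by norm_num; exact hR.contDiffAt ht)

/-- The first-order lower bound for self-concordant functions. -/
theorem add_sub_log_le (hR : IsSelfConcordantBarrier F R ϑ) (hF : Convex ℝ F)
    {h g : EuclideanSpace ℝ (Fin n)} (hh : h ∈ interior F) (hg : g ∈ interior F) :
    R h + fderiv ℝ R h (g - h) + (√(hessianForm R h (g - h) (g - h)) -
      Real.log (1 + √(hessianForm R h (g - h) (g - h)))) ≤ R g := by
  have hseg : ∀ t ∈ Set.Icc (0 : ℝ) 1, h + t • (g - h) ∈ interior F := fun t ht =>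
    hF.interior.add_smul_sub_mem hh hg ht
  have := add_sub_log_le_of_sq_div_le
    (Real.sqrt_nonneg (hessianForm R h (g - h) (g - h)))
    (fun t ht => hR.hasDerivAt_line (hseg t ht))
    (fun t ht => hR.hasDerivAt_fderiv_line (hseg t ht))
    (fun t ht => by
      have hsub : ∀ y ∈ Set.Icc 0 t, y ∈ Set.Icc (0 : ℝ) 1 := fun y hy => ⟨hy.1, hy.2.trans ht.2⟩
      have := sq_div_le_of_abs_deriv_le
        (fun y hy => hR.hasDerivAt_hessianForm_line (hseg y (hsub y hy)))
        (fun y hy => hR.hessianForm_self_nonneg (hseg y (hsub y hy)) _)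
        (fun y hy => hR.abs_third_le _ (hseg y (hsub y hy)) _) ht.1
      simpa using this)
  simpa using this

/-- The open Dikin ellipsoid around an interior point lies in the interior. -/
theorem add_mem_interior (hR : IsSelfConcordantBarrier F R ϑ) {h u : EuclideanSpace ℝ (Fin n)}
    (hh : h ∈ interior F) (hu : hessianForm R h u u < 1) : h + u ∈ interior F := by
  by_contra hcon
  -- Take the first exit time `b` of the segment. The Hessian stays bounded before `b`, hence so
  -- does `R`, contradicting blow-up at the exit point.
  let A : Set ℝ := {t | t ∈ Set.Icc (0 : ℝ) 1 ∧ h + t • u ∉ interior F}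
  have hcont : Continuous fun t : ℝ => h + t • u := by fun_prop
  have hAc : IsClosed A :=
    isClosed_Icc.inter ((isOpen_interior.preimage hcont).isClosed_compl)
  have hAne : A.Nonempty := ⟨1, by simp, by simpa using hcon⟩
  have hAbdd : BddBelow A := ⟨0, fun t ht => ht.1.1⟩
  obtain ⟨⟨hb0, hb1⟩, hbF⟩ : sInf A ∈ A := hAc.csInf_mem hAne hAbdd
  set b := sInf A with hb
  have hin : ∀ t, 0 ≤ t → t < b → h + t • u ∈ interior F := fun t ht htb => by
    by_contra hc
    exact absurd (csInf_le hAbdd (show t ∈ A from ⟨⟨ht, htb.le.trans hb1⟩, hc⟩)) (not_le.2 htb)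
  have hbpos : 0 < b := by
    refine lt_of_le_of_ne hb0 fun h0 => hbF ?_
    rw [← h0]; simpa using hh
  have hev : ∀ᶠ t in 𝓝[<] b, 0 ≤ t ∧ t < b :=
    Filter.mem_of_superset (Ioo_mem_nhdsLT hbpos) fun t ht => ⟨ht.1.le, ht.2⟩
  have hlim : Filter.Tendsto (fun t : ℝ => h + t • u) (𝓝[<] b) (𝓝[interior F] (h + b • u)) :=
    tendsto_nhdsWithin_iff.2 ⟨hcont.continuousAt.tendsto.mono_left nhdsWithin_le_nhds,
      hev.mono fun t ht => hin t ht.1 ht.2⟩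
  have hfr : h + b • u ∈ frontier F := by
    refine ⟨closure_mono interior_subset (mem_closure_iff_nhdsWithin_neBot.2 ?_), hbF⟩
    exact hlim.neBot
  have htop := (hR.tendsto_atTop _ hfr).comp hlim
  obtain ⟨M, hM⟩ := exists_bound_of_abs_deriv_le (hR.hessianForm_self_nonneg hh u) hu
  have hbound : ∀ t, 0 ≤ t → t < b →
      R (h + t • u) ≤ R h + |fderiv ℝ R h u| + |M| := fun t ht htb => by
    have hmem : ∀ y ∈ Set.Icc 0 t, h + y • u ∈ interior F := fun y hy =>
      hin y hy.1 (hy.2.trans_lt htb)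
    have hq : ∀ y ∈ Set.Icc 0 t, hessianForm R (h + y • u) u u ≤ M := fun y hy =>
      hM (fun t => hessianForm R (h + t • u) u u) _ y (by simp) hy.1
        (hy.2.trans (htb.le.trans hb1))
        (fun z hz => hR.hasDerivAt_hessianForm_line (hmem z ⟨hz.1, hz.2.trans hy.2⟩))
        (fun z hz => hR.hessianForm_self_nonneg (hmem z ⟨hz.1, hz.2.trans hy.2⟩) _)
        (fun z hz => hR.abs_third_le _ (hmem z ⟨hz.1, hz.2.trans hy.2⟩) _)
    have h1 := le_of_second_deriv_le ht (fun y hy => hR.hasDerivAt_line (hmem y hy))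
      (fun y hy => hR.hasDerivAt_fderiv_line (hmem y hy)) hq
    have ht1 : t ≤ 1 := htb.le.trans hb1
    simp only [zero_smul, add_zero] at h1
    have h2 : fderiv ℝ R h u * t ≤ |fderiv ℝ R h u| := by
      nlinarith [le_abs_self (fderiv ℝ R h u), abs_nonneg (fderiv ℝ R h u)]
    have h3 : M / 2 * t ^ 2 ≤ |M| := by
      nlinarith [le_abs_self M, abs_nonneg M, sq_nonneg t, pow_le_one₀ ht ht1 (n := 2)]
    linarith
  obtain ⟨t, ⟨ht0, htb⟩, htR⟩ := (hev.and
    (htop.eventually_gt_atTop (R h + |fderiv ℝ R h u| + |M|))).exists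
  exact absurd (hbound t ht0 htb) (not_le.2 htR)

/-- The closed Dikin ellipsoid around an interior point lies in a closed domain. -/
theorem add_mem (hR : IsSelfConcordantBarrier F R ϑ) (hF : IsClosed F)
    {h u : EuclideanSpace ℝ (Fin n)} (hh : h ∈ interior F) (hu : hessianForm R h u u ≤ 1) :
    h + u ∈ F := by
  have hlim : Filter.Tendsto (fun c : ℝ => h + c • u) (𝓝[<] 1) (𝓝 (h + (1 : ℝ) • u)) :=
    (ContinuousAt.tendsto (f := fun c : ℝ => h + c • u) (by fun_prop)).mono_left
      nhdsWithin_le_nhds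
  rw [one_smul] at hlim
  refine hF.mem_of_tendsto hlim ?_
  filter_upwards [Ioo_mem_nhdsLT (zero_lt_one' ℝ)] with c hc
  refine interior_subset (hR.add_mem_interior hh ?_)
  rw [hessianForm_smul_self]
  have := hR.hessianForm_self_nonneg hh u
  nlinarith [pow_lt_one₀ hc.1.le hc.2 two_ne_zero]

/-- On a bounded domain the Hessian of a self-concordant barrier is positive definite. -/
theorem hessianForm_self_pos (hR : IsSelfConcordantBarrier F R ϑ) (hF : Bornology.IsBounded F)
    {h u : EuclideanSpace ℝ (Fin n)} (hh : h ∈ interior F) (hu : u ≠ 0) :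
    0 < hessianForm R h u u := by
  refine lt_of_le_of_ne (hR.hessianForm_self_nonneg hh u) fun h0 => ?_
  obtain ⟨C, hC⟩ := hF.exists_norm_le
  -- A null direction would put a whole line inside the Dikin ellipsoid.
  have hmem : ∀ c : ℝ, h + c • u ∈ F := fun c => interior_subset
    (hR.add_mem_interior hh (by rw [hessianForm_smul_self, ← h0]; norm_num))
  have hun : 0 < ‖u‖ := norm_pos_iff.2 hu
  have h1 := hC _ (hmem ((C + ‖h‖ + 1) / ‖u‖))
  have hC0 : 0 ≤ C := (norm_nonneg _).trans (hC _ (hmem 0))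
  have h2 : ‖((C + ‖h‖ + 1) / ‖u‖) • u‖ = C + ‖h‖ + 1 := by
    rw [norm_smul, Real.norm_of_nonneg (by positivity), div_mul_cancel₀ _ hun.ne']
  have h3 := norm_sub_le (h + ((C + ‖h‖ + 1) / ‖u‖) • u) h
  rw [add_sub_cancel_left, h2] at h3
  linarith

/-- Linear perturbations of a minimizer of `⟨·, S⟩ + R` over the interior lower the minimum by at
most twice the squared dual local norm of the perturbation. -/
theorem le_inner_add_of_isMinOn (hR : IsSelfConcordantBarrier F R ϑ) (hF : Convex ℝ F)
    {h g S y : EuclideanSpace ℝ (Fin n)} (hh : h ∈ interior F) (hg : g ∈ interior F)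
    (hmin : IsMinOn (fun g => ⟪g, S⟫ + R g) (interior F) h) {a : ℝ} (ha : a ≤ 1 / 2)
    (hy : -(a * √(hessianForm R h (g - h) (g - h))) ≤ ⟪g - h, y⟫) :
    ⟪h, S⟫ + R h + ⟪h, y⟫ - 2 * a ^ 2 ≤ ⟪g, S⟫ + R g + ⟪g, y⟫ := by
  have hloc := (hmin.isLocalMin (isOpen_interior.mem_nhds hh)).fderiv_eq_zero
  have hRd : DifferentiableAt ℝ R h := (hR.contDiffAt hh).differentiableAt (by norm_num)
  have hd : HasFDerivAt (fun g => ⟪g, S⟫ + R g) (innerSL ℝ S + fderiv ℝ R h) h := by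
    refine HasFDerivAt.add ?_ hRd.hasFDerivAt
    simpa [real_inner_comm] using (innerSL ℝ S).hasFDerivAt (x := h)
  rw [hd.fderiv] at hloc
  -- Stationarity cancels the linear terms, leaving `r - log (1 + r) - a r`.
  have h1 : ⟪S, g - h⟫ + fderiv ℝ R h (g - h) = 0 := by
    simpa using congrArg (fun L => L (g - h)) hloc
  have h2 := hR.add_sub_log_le hF hh hg
  have h3 := neg_two_mul_sq_le_sub_log ha (Real.sqrt_nonneg (hessianForm R h (g - h) (g - h)))
  rw [real_inner_comm, inner_sub_left] at h1
  rw [inner_sub_left] at hy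
  linarith

end IsSelfConcordantBarrier

end Barrier

/-! ### The extended-valued barrier. -/

section ExtBarrier

variable {n : ℕ} {F : Set (EuclideanSpace ℝ (Fin n))} {R : EuclideanSpace ℝ (Fin n) → ℝ}

theorem extBarrier_of_mem {f : EuclideanSpace ℝ (Fin n)} (hf : f ∈ interior F) :
    extBarrier F R f = (R f : ℝ) := if_pos hf

theorem extBarrier_of_notMem {f : EuclideanSpace ℝ (Fin n)} (hf : f ∉ interior F) :
    extBarrier F R f = ⊤ := if_neg hf

/-- A minimizer of a finite function plus the barrier is interior, and minimizes over the
interior. -/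
theorem isMinOn_interior_of_extBarrier {ℓ : EuclideanSpace ℝ (Fin n) → ℝ}
    (hne : (interior F).Nonempty) {h : EuclideanSpace ℝ (Fin n)}
    (hmin : IsMinOn (fun g => (ℓ g : EReal) + extBarrier F R g) F h) :
    h ∈ interior F ∧ IsMinOn (fun g => ℓ g + R g) (interior F) h := by
  obtain ⟨g₀, hg₀⟩ := hne
  have hh : h ∈ interior F := by
    by_contra hc
    have h1 := isMinOn_iff.1 hmin g₀ (interior_subset hg₀)
    rw [extBarrier_of_notMem hc, extBarrier_of_mem hg₀, EReal.coe_add_top, ← EReal.coe_add,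
      top_le_iff] at h1
    exact EReal.coe_ne_top _ h1
  refine ⟨hh, isMinOn_iff.2 fun g hg => ?_⟩
  have h1 := isMinOn_iff.1 hmin g (interior_subset hg)
  rw [extBarrier_of_mem hh, extBarrier_of_mem hg, ← EReal.coe_add, ← EReal.coe_add] at h1
  exact EReal.coe_le_coe_iff.1 h1

theorem interior_nonempty_of_isLeast (hmin : IsLeast (extBarrier F R '' F) 0) :
    (interior F).Nonempty := by
  obtain ⟨f, _, hf⟩ := hmin.1
  refine ⟨f, by_contra fun hc => ?_⟩
  rw [extBarrier_of_notMem hc] at hf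
  exact EReal.top_ne_zero hf

theorem nonneg_of_isLeast (hmin : IsLeast (extBarrier F R '' F) 0)
    {g : EuclideanSpace ℝ (Fin n)} (hg : g ∈ interior F) : 0 ≤ R g := by
  have := hmin.2 ⟨g, interior_subset hg, rfl⟩
  rw [extBarrier_of_mem hg] at this
  exact_mod_cast this

end ExtBarrier

/-! ### Conditioning on all coins but one. -/

section Resampling

/-- Two quantities with the same conditional expectation given all coins but those of round `t`
have the same expectation. -/
theorem expect_eq_of_sum_update_eq {n T : ℕ} [NeZero n] {G H : Coins n T → ℝ} (t : Fin T)
    (h : ∀ ω, ∑ c, G (Function.update ω t c) = ∑ c, H (Function.update ω t c)) :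
    𝔼 ω, G ω = 𝔼 ω, H ω := by
  have key : ∀ K : Coins n T → ℝ, ∑ ω, ∑ c, K (Function.update ω t c) =
      Fintype.card (Fin n × ℤˣ) * ∑ ω, K ω := by
    intro K
    -- Exchanging the fresh coin with the one it replaces is an involution, so resampling preserves
    -- the uniform sum.
    let e : Coins n T × (Fin n × ℤˣ) → Coins n T × (Fin n × ℤˣ) :=
      fun p => (Function.update p.1 t p.2, p.1 t)
    have he : Function.Involutive e := fun p => by simp [e]
    calc ∑ ω, ∑ c, K (Function.update ω t c)
        = ∑ p : Coins n T × (Fin n × ℤˣ), K (e p).1 := by rw [Fintype.sum_prod_type]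
      _ = ∑ p : Coins n T × (Fin n × ℤˣ), K p.1 :=
          Function.Bijective.sum_comp he.bijective (fun p => K p.1)
      _ = _ := by
          rw [Fintype.sum_prod_type]
          simp [Finset.mul_sum]
  have hs := Finset.sum_congr (rfl : (Finset.univ : Finset (Coins n T)) = _) fun ω _ => h ω
  rw [key, key] at hs
  have hc : (Fintype.card (Fin n × ℤˣ) : ℝ) ≠ 0 := Nat.cast_ne_zero.2 Fintype.card_ne_zero
  rw [Fintype.expect_eq_sum_div_card, Fintype.expect_eq_sum_div_card, mul_left_cancel₀ hc hs]

end Resampling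

theorem units_int_cast_sq (ε : ℤˣ) : ((ε : ℤ) : ℝ) ^ 2 = 1 := by
  rcases Int.units_eq_one_or ε with h | h <;> simp [h]

/-! ### Analysis of a run. -/

namespace ScribleRun

variable {n : ℕ} {F : Set (EuclideanSpace ℝ (Fin n))} {R : EuclideanSpace ℝ (Fin n) → ℝ}
  {ϑ η : ℝ} {T : ℕ} {x : Fin T → Coins n T → EuclideanSpace ℝ (Fin n)}

theorem h_mem_interior (run : ScribleRun F R η T x) (hne : (interior F).Nonempty) (t : Fin T)
    (ω : Coins n T) : run.h t ω ∈ interior F :=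
  (isMinOn_interior_of_extBarrier hne (run.h_isMinOn t ω)).1

theorem eigval_eq (run : ScribleRun F R η T x) (t : Fin T) (ω : Coins n T) (i : Fin n) :
    run.eigval t ω i = hessianForm R (run.h t ω) (run.v t ω i) (run.v t ω i) := by
  rw [run.v_eigen]; simp

/-- The eigenvalues are Rayleigh quotients, hence determined by `h` and `v`; no separate rule for
them is needed. -/
theorem eigval_decidedBefore (run : ScribleRun F R η T x) : DecidedBefore run.eigval := by
  intro t ω ω' h
  ext i
  rw [run.eigval_eq, run.eigval_eq, run.h_decidedBefore t ω ω' h, run.v_decidedBefore t ω ω' h]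

theorem eigval_pos (run : ScribleRun F R η T x) (hR : IsSelfConcordantBarrier F R ϑ)
    (hF : Bornology.IsBounded F) (hne : (interior F).Nonempty) (t : Fin T) (ω : Coins n T)
    (i : Fin n) : 0 < run.eigval t ω i := by
  rw [run.eigval_eq]
  exact hR.hessianForm_self_pos hF (run.h_mem_interior hne t ω)
    ((run.v t ω).orthonormal.ne_zero i)

/-- The predictions are feasible: they lie on the Dikin ellipsoid. -/
theorem f_mem (run : ScribleRun F R η T x) (hR : IsSelfConcordantBarrier F R ϑ)
    (hF : IsCompact F) (hne : (interior F).Nonempty) (t : Fin T) (ω : Coins n T) :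
    run.f t ω ∈ F := by
  rw [run.f_eq]
  refine hR.add_mem hF.isClosed (run.h_mem_interior hne t ω) ?_
  have hp := run.eigval_pos hR hF.isBounded hne t ω (ω t).1
  rw [hessianForm_smul_self, ← run.eigval_eq, mul_pow, units_int_cast_sq, inv_pow, Real.sq_sqrt hp.le,
    one_mul, inv_mul_cancel₀ hp.ne']

/-- The local norm controls the pairing with the estimated move. -/
theorem abs_inner_xEst_le (run : ScribleRun F R η T x) (hR : IsSelfConcordantBarrier F R ϑ)
    (hF : Bornology.IsBounded F) (hne : (interior F).Nonempty) (t : Fin T) (ω : Coins n T)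
    (u : EuclideanSpace ℝ (Fin n)) :
    |⟪u, run.xEst t ω⟫| ≤ n * |⟪run.f t ω, x t ω⟫| * √(hessianForm R (run.h t ω) u u) := by
  have hp := run.eigval_pos hR hF hne t ω
  set i := (ω t).1
  have h1 : |√(run.eigval t ω i) * ⟪run.v t ω i, u⟫| ≤ √(hessianForm R (run.h t ω) u u) := by
    refine Real.abs_le_sqrt ?_
    rw [mul_pow, Real.sq_sqrt (hp i).le, hessianForm_eq_sum (run.v_eigen t ω)]
    exact Finset.single_le_sum (f := fun i => run.eigval t ω i * ⟪run.v t ω i, u⟫ ^ 2)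
      (fun j _ => mul_nonneg (hp j).le (sq_nonneg _)) (Finset.mem_univ i)
  have h2 : ⟪u, run.xEst t ω⟫ = n * ⟪run.f t ω, x t ω⟫ * (((ω t).2 : ℤ) : ℝ) *
      (√(run.eigval t ω i) * ⟪run.v t ω i, u⟫) := by
    rw [run.xEst_eq, real_inner_smul_right, real_inner_comm u]
    ring
  have h3 : |(((ω t).2 : ℤ) : ℝ)| = 1 := by
    rcases Int.units_eq_one_or (ω t).2 with h | h <;> simp [h]
  rw [h2, abs_mul, abs_mul, abs_mul, h3, mul_one, Nat.abs_cast]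
  exact mul_le_mul_of_nonneg_left h1 (by positivity)

/-- The estimated move is unbiased, and the prediction is centred at `h_t`. -/
theorem expect_inner_f_sub (run : ScribleRun F R η T x) [NeZero n]
    (hR : IsSelfConcordantBarrier F R ϑ) (hF : Bornology.IsBounded F)
    (hne : (interior F).Nonempty) (hx : DecidedBefore x) (g : EuclideanSpace ℝ (Fin n))
    (t : Fin T) :
    𝔼 ω, ⟪run.f t ω - g, x t ω⟫ = 𝔼 ω, ⟪run.h t ω - g, run.xEst t ω⟫ := by
  refine expect_eq_of_sum_update_eq t fun ω => ?_
  have hpast : ∀ c, ∀ r < t, Function.update ω t c r = ω r := fun c r hr =>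
    Function.update_of_ne hr.ne _ _
  have hp := run.eigval_pos hR hF hne t ω
  simp only [run.xEst_eq, run.f_eq, run.h_decidedBefore t _ _ (hpast _),
    run.v_decidedBefore t _ _ (hpast _), run.eigval_decidedBefore t _ _ (hpast _),
    hx t _ _ (hpast _), Function.update_self, Fintype.sum_prod_type, UnitsInt.univ]
  have h1 : ∀ i, √(run.eigval t ω i) * (√(run.eigval t ω i))⁻¹ = 1 := fun i =>
    mul_inv_cancel₀ (Real.sqrt_pos.2 (hp i)).ne'
  have h2 := (run.v t ω).sum_inner_mul_inner (run.h t ω - g) (x t ω)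
  -- Summing over the sign removes the terms odd in `ε`. In the estimate, the `ε²` term survives and
  -- `√λ` cancels `1/√λ`; the factor `n` offsets the uniform choice of `i`.
  calc _ = ∑ _i : Fin n, 2 * ⟪run.h t ω - g, x t ω⟫ := Finset.sum_congr rfl fun i _ => by
        rw [Finset.sum_pair (by decide)]
        simp only [inner_sub_left, inner_add_left, real_inner_smul_left]
        push_cast
        ring
    _ = ∑ i, 2 * n * (⟪run.h t ω - g, run.v t ω i⟫ * ⟪run.v t ω i, x t ω⟫) := by
        rw [Finset.sum_const, ← Finset.mul_sum, h2, Finset.card_univ, Fintype.card_fin,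
          nsmul_eq_mul]
        ring
    _ = _ := Finset.sum_congr rfl fun i _ => by
        rw [Finset.sum_pair (by decide)]
        simp only [inner_add_left, real_inner_smul_left, real_inner_smul_right]
        push_cast
        linear_combination (-2 * n * ⟪run.h t ω - g, run.v t ω i⟫ *
          ⟪run.v t ω i, x t ω⟫) * h1 i

/-- The follow-the-regularized-leader bound against an interior comparator. -/
theorem sum_inner_h_le (run : ScribleRun F R η T x) (hR : IsSelfConcordantBarrier F R ϑ)
    (hFc : Convex ℝ F) (hF : Bornology.IsBounded F) (hmin : IsLeast (extBarrier F R '' F) 0)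
    (hη : 0 < η) (hstep : ∀ t ω, η * (n * |⟪run.f t ω, x t ω⟫|) ≤ 1 / 2) (ω : Coins n T) (k : ℕ)
    {g : EuclideanSpace ℝ (Fin n)} (hg : g ∈ interior F) :
    ∑ r : Fin T with r.val < k, (η * ⟪run.h r ω, run.xEst r ω⟫ -
        2 * (η * (n * |⟪run.f r ω, x r ω⟫|)) ^ 2) ≤
      η * ⟪g, ∑ r : Fin T with r.val < k, run.xEst r ω⟫ + R g := by
  have hne := interior_nonempty_of_isLeast hmin
  -- The comparator must vary: the inductive hypothesis is used at `h_t`, and optimality of `h_t`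
  -- then passes to an arbitrary `g`.
  induction k generalizing g with
  | zero => simpa using nonneg_of_isLeast hmin hg
  | succ k ih =>
    by_cases hk : k < T
    · set t : Fin T := ⟨k, hk⟩
      have hfilter : (Finset.univ.filter fun r : Fin T => r.val < k + 1) =
          insert t (Finset.univ.filter fun r : Fin T => r.val < k) := by
        ext r
        simp [t, Fin.ext_iff]
        omega
      have hiio : (Finset.univ.filter fun r : Fin T => r.val < k) = Finset.Iio t := by
        ext r
        simp [t, Fin.lt_def]
      rw [hfilter, Finset.sum_insert (by simp [t]), Finset.sum_insert (by simp [t])]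
      have hh := run.h_mem_interior hne t ω
      have h1 := ih hh
      have h2 := (isMinOn_interior_of_extBarrier hne (run.h_isMinOn t ω)).2
      rw [← hiio] at h2
      set S := ∑ r : Fin T with r.val < k, run.xEst r ω
      have h3 := hR.le_inner_add_of_isMinOn hFc (S := η • S) (y := η • run.xEst t ω) hh hg
        (by simpa only [real_inner_smul_right] using h2) (hstep t ω) (by
          have h4 := (abs_le.1 (run.abs_inner_xEst_le hR hF hne t ω (g - run.h t ω))).1
          rw [real_inner_smul_right, mul_assoc, ← mul_neg]
          exact mul_le_mul_of_nonneg_left h4 hη.le)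
      simp only [real_inner_smul_right] at h3
      rw [inner_add_right]
      linarith
    · have hfilter : (Finset.univ.filter fun r : Fin T => r.val < k + 1) =
          Finset.univ.filter fun r : Fin T => r.val < k := by
        ext r
        simp
        omega
      rw [hfilter]
      exact ih hg

/-- The regret against the estimated moves. -/
theorem sum_inner_h_sub_le (run : ScribleRun F R η T x) (hR : IsSelfConcordantBarrier F R ϑ)
    (hFc : Convex ℝ F) (hF : Bornology.IsBounded F) (hmin : IsLeast (extBarrier F R '' F) 0)
    (hη : 0 < η) (hstep : ∀ t ω, η * (n * |⟪run.f t ω, x t ω⟫|) ≤ 1 / 2) (ω : Coins n T)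
    {g : EuclideanSpace ℝ (Fin n)} (hg : g ∈ interior F) :
    ∑ t, ⟪run.h t ω - g, run.xEst t ω⟫ ≤
      ∑ t, 2 * η * n ^ 2 * ⟪run.f t ω, x t ω⟫ ^ 2 + η⁻¹ * R g := by
  have h1 := run.sum_inner_h_le hR hFc hF hmin hη hstep ω T hg
  have hfilter : (Finset.univ.filter fun r : Fin T => r.val < T) = Finset.univ := by
    ext r; simp
  rw [hfilter, inner_sum, Finset.sum_sub_distrib, ← Finset.mul_sum] at h1
  simp only [inner_sub_left, Finset.sum_sub_distrib]
  have h2 : ∑ t, 2 * (η * (n * |⟪run.f t ω, x t ω⟫|)) ^ 2 =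
      η * ∑ t, 2 * η * n ^ 2 * ⟪run.f t ω, x t ω⟫ ^ 2 := by
    rw [Finset.mul_sum]
    refine Finset.sum_congr rfl fun t _ => ?_
    rw [mul_pow, mul_pow, sq_abs]
    ring
  rw [h2] at h1
  have h3 : η * (η⁻¹ * R g) = R g := mul_inv_cancel_left₀ hη.ne' _
  refine le_of_mul_le_mul_left ?_ hη
  linarith

end ScribleRun

/-! ### The expected loss bound. -/

theorem mainTheorem12 {n : ℕ} (hn : 1 ≤ n)
    (F : Set (EuclideanSpace ℝ (Fin n))) (hFconv : Convex ℝ F) (hFcomp : IsCompact F)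
    (R : EuclideanSpace ℝ (Fin n) → ℝ) (ϑ : ℝ) (hR : IsSelfConcordantBarrier F R ϑ)
    (hmin : IsLeast (extBarrier F R '' F) 0)
    (X : Set (EuclideanSpace ℝ (Fin n))) (s : ℝ)
    (hloss : ∀ f ∈ F, ∀ x ∈ X, ⟪f, x⟫ ∈ Set.Icc 0 s)
    (η : ℝ) (hη : 0 < η) (hηs : 2 * s * (n : ℝ) ^ 2 * η < 1)
    (T : ℕ) (x : Fin T → Coins n T → EuclideanSpace ℝ (Fin n))
    (hxX : ∀ t ω, x t ω ∈ X) (hx : DecidedBefore x)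
    (run : ScribleRun F R η T x)
    (fstar : EuclideanSpace ℝ (Fin n)) (hfstar : fstar ∈ F) :
    ((𝔼 ω : Coins n T, ∑ t, ⟪run.f t ω, x t ω⟫ : ℝ) : EReal) ≤
      ((1 / (1 - 2 * s * (n : ℝ) ^ 2 * η) : ℝ) : EReal) *
        (((𝔼 ω : Coins n T, ∑ t, ⟪fstar, x t ω⟫ : ℝ) : EReal) +
          ((η⁻¹ : ℝ) : EReal) * extBarrier F R fstar) := by
  have hc : 0 < 1 - 2 * s * (n : ℝ) ^ 2 * η := by linarith
  by_cases hint : fstar ∈ interior F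
  swap
  -- Off the interior the right-hand side is `⊤`, since both real factors are positive.
  · rw [extBarrier_of_notMem hint, EReal.coe_mul_top_of_pos (inv_pos.2 hη), EReal.coe_add_top,
      EReal.coe_mul_top_of_pos (one_div_pos.2 hc)]
    exact le_top
  have : NeZero n := ⟨by omega⟩
  have hne := interior_nonempty_of_isLeast hmin
  have hf : ∀ t ω, ⟪run.f t ω, x t ω⟫ ∈ Set.Icc 0 s := fun t ω =>
    hloss _ (run.f_mem hR hFcomp hne t ω) _ (hxX t ω)
  have hn1 : (1 : ℝ) ≤ n := by exact_mod_cast hn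
  have hstep : ∀ t ω, η * (n * |⟪run.f t ω, x t ω⟫|) ≤ 1 / 2 := fun t ω => by
    rw [abs_of_nonneg (hf t ω).1]
    have h1 : (n : ℝ) * ⟪run.f t ω, x t ω⟫ ≤ n ^ 2 * s :=
      mul_le_mul (le_self_pow₀ hn1 two_ne_zero) (hf t ω).2 (hf t ω).1 (by positivity)
    have h2 := mul_le_mul_of_nonneg_left h1 hη.le
    linarith
  rw [extBarrier_of_mem hint, ← EReal.coe_mul, ← EReal.coe_add, ← EReal.coe_mul,
    EReal.coe_le_coe_iff, one_div, ← div_eq_inv_mul, le_div_iff₀ hc]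
  have hpath : ∀ ω, ∑ t, ⟪run.h t ω - fstar, run.xEst t ω⟫ ≤
      2 * s * (n : ℝ) ^ 2 * η * ∑ t, ⟪run.f t ω, x t ω⟫ + η⁻¹ * R fstar := fun ω => by
    refine (run.sum_inner_h_sub_le hR hFconv hFcomp.isBounded hmin hη hstep ω hint).trans ?_
    rw [Finset.mul_sum]
    refine add_le_add (Finset.sum_le_sum fun t _ => ?_) le_rfl
    -- Self-bounding: the quadratic term becomes a multiple of the learner's own loss.
    have h1 : ⟪run.f t ω, x t ω⟫ ^ 2 ≤ s * ⟪run.f t ω, x t ω⟫ := by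
      rw [sq]; exact mul_le_mul_of_nonneg_right (hf t ω).2 (hf t ω).1
    calc _ ≤ 2 * η * n ^ 2 * (s * ⟪run.f t ω, x t ω⟫) :=
          mul_le_mul_of_nonneg_left h1 (by positivity)
      _ = _ := by ring
  have hexp := Finset.expect_le_expect (s := Finset.univ) fun ω _ => hpath ω
  rw [Finset.expect_add_distrib, ← Finset.mul_expect, Fintype.expect_const,
    Finset.expect_sum_comm, ← Finset.sum_congr rfl fun t _ =>
      run.expect_inner_f_sub hR hFcomp.isBounded hne hx fstar t, ← Finset.expect_sum_comm] at hexp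
  simp only [inner_sub_left, Finset.sum_sub_distrib, Finset.expect_sub_distrib] at hexp
  linarith
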